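/- Let $\mathbb{K}$ be a field of characteristic $0$. For a finite set $V$, a hypergraph over $V$ is a finite multiset $h$ of non-empty subsets of $V$ (its edges); let $HG[V]$ be the $\mathbb{K}$-vector space with basis the hypergraphs over $V$. For disjoint finite sets $V_1,V_2$, let $\mu_{V_1,V_2}:HG[V_1]\otimes HG[V_2]\to HG[V_1\sqcup V_2]$ be the linear extension of disjoint union, and let $\Delta_{V_1,V_2}:HG[V_1\sqcup V_2]\to HG[V_1]\otimes HG[V_2]$ be the linear map with $\Delta_{V_1,V_2}(h)=\{e\in h: e\subseteq V_1\}\otimes\{e\setminus V_1: e\in h,\ e\not\subseteq V_1\}$. Write $\mu_{V_1,\dots,V_n}$ and $\Delta_{V_1,\dots,V_n}$ for the iterated maps. A character $\zeta$ of $HG$ is a collection of linear forms $\zeta_V:HG[V]\to\mathbb{K}$ with $\zeta_{V_1\sqcup V_2}(x\cdot y)=\zeta_{V_1}(x)\zeta_{V_2}(y)$ and with value $1$ on the empty hypergraph over $\emptyset$. For $n\in\mathbb{N}$ and $h$ a hypergraph over $V$ put $$\chi^\zeta_V(h)(n)=\sum_{V=V_1\sqcup\dots\sqcup V_n}\zeta_V\big(\mu_{V_1,\dots,V_n}(\Delta_{V_1,\dots,V_n}(h))\big),$$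 the sum being over sequences of $n$ pairwise disjoint, possibly empty, subsets with union $V$. An admissible orientation $f$ of $h$ assigns to each edge $e$ of $h$ (copies of a repeated edge being distinguished) a non-empty subset $f(e)\subseteq e$; write $f_s(e)=e\setminus f(e)$, and let $f(h)$ be the hypergraph over $V$ with edges $f(e)$, $e\in h$. It is acyclic if there is no sequence of $k\ge 1$ distinct edges $e_1,\dots,e_k$ such that for each $1\le i<k$ either $f(e_i)\cap f_s(e_{i+1})\neq\emptyset$ or $\emptyset\subsetneq f(e_i)\cap e_{i+1}\subsetneq f(e_{i+1})$, and such that $f(e_k)\cap f_s(e_1)\ne\emptyset$. A coloring $c:V\to[n]$ is compatible with $f$ if for every edge $e$ each element of $f(e)$ has maximal color among the elements of $e$. Let $\mathcal{A}_h$ be the set of acyclic orientations of $h$, let $C_{h,f,n}$ be the set of colorings of $V$ with $[n]$ compatible with $f$, and let $cc(g)$ be the number of connected components of a hypergraph $g$ over $V$ (a vertex contained in no edge counts as a component). **Theorem.** Let $\zeta$ be a character of $HG$, $V$ a finite set and $h$ a hypergraph over $V$. Then $n\mapsto\chi^\zeta_V(h)(n)$ is given on $\mathbb{N}$ by a polynomial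 with coefficients in $\mathbb{K}$, and the values of this polynomial at non-positive integers are, for all $n\in\mathbb{N}$, $$\chi^\zeta_V(h)(-n)=\sum_{f\in\mathcal{A}_h}(-1)^{cc(f(h))}\,\zeta(f(h))\,|C_{h,f,n}|.$$ Suppose moreover that $\zeta$ is a characteristic function (its value on every hypergraph is $0$ or $1$) and is odd ($\zeta(g)=0$ for every hypergraph $g$ that has a connected component with an even number of vertices). Then, for all $n\in\mathbb{N}$, $(-1)^{|V|}\chi^\zeta_V(h)(-n)$ is the number of pairs $(f,c)$ where $f$ is an acyclic orientation of $h$ with $\zeta(f(h))\neq 0$ and $c$ is a coloring of $V$ with $[n]$ compatible with $f$. In particular, $(-1)^{|V|}\chi^\zeta_V(h)(-1)$ is the number of acyclic orientations $f$ of $h$ with $\zeta(f(h))\ne 0$. -/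

import Mathlib

open scoped TensorProduct

noncomputable section

namespace HypergraphMonoid

universe u v

/-- A hypergraph over the finite set `V`: a multiset of nonempty subsets of `V`. The finite sets
are the finite subsets of an arbitrary type `U`, so that disjoint unions are honest unions. -/
@[ext]
structure Hypergraph {U : Type u} (V : Finset U) where
  edges : Multiset (Finset U)
  nonempty_of_mem : ∀ e ∈ edges, e.Nonempty
  subset_of_mem : ∀ e ∈ edges, e ⊆ V

namespace Hypergraph

variable {U : Type u}

/-- The same hypergraph, seen over a finite set that is equal to the given one. -/
def copy {V W : Finset U} (h : Hypergraph V) (hVW : V = W) : Hypergraph W where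
  edges := h.edges
  nonempty_of_mem := h.nonempty_of_mem
  subset_of_mem e he := hVW ▸ h.subset_of_mem e he

/-- The hypergraph without edges over the empty set. -/
def empty : Hypergraph (∅ : Finset U) where
  edges := 0
  nonempty_of_mem e he := absurd he (Multiset.notMem_zero e)
  subset_of_mem e he := absurd he (Multiset.notMem_zero e)

variable [DecidableEq U]

/-- The disjoint union of a hypergraph over `V` and a hypergraph over `W`. -/
def union {V W : Finset U} (h : Hypergraph V) (k : Hypergraph W) : Hypergraph (V ∪ W) where
  edges := h.edges + k.edges
  nonempty_of_mem e he := (Multiset.mem_add.1 he).elim (h.nonempty_of_mem e) (k.nonempty_of_mem e)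
  subset_of_mem e he := (Multiset.mem_add.1 he).elim
    (fun h1 => (h.subset_of_mem e h1).trans Finset.subset_union_left)
    (fun h2 => (k.subset_of_mem e h2).trans Finset.subset_union_right)

/-- The restriction `h|_V = {e ∈ h | e ⊆ V}` of a hypergraph over `V ⊔ W`. -/
def restrict {V W : Finset U} (h : Hypergraph (V ∪ W)) : Hypergraph V where
  edges := h.edges.filter (fun e => e ⊆ V)
  nonempty_of_mem e he := h.nonempty_of_mem e (Multiset.mem_of_mem_filter he)
  subset_of_mem _ he := (Multiset.mem_filter.1 he).2

/-- The contraction `h/_V = {e ∩ Vᶜ | e ∈ h, e ⊈ V}` of a hypergraph over `V ⊔ W`. -/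
def contract {V W : Finset U} (h : Hypergraph (V ∪ W)) : Hypergraph W where
  edges := (h.edges.filter (fun e => ¬ e ⊆ V)).map (fun e => e \ V)
  nonempty_of_mem s hs := by
    obtain ⟨e, he, rfl⟩ := Multiset.mem_map.1 hs
    exact Finset.sdiff_nonempty.2 (Multiset.mem_filter.1 he).2
  subset_of_mem s hs := by
    obtain ⟨e, he, rfl⟩ := Multiset.mem_map.1 hs
    exact sdiff_le_iff.2 (h.subset_of_mem e (Multiset.mem_of_mem_filter he))

end Hypergraph

/-! ### The Hopf monoid of hypergraphs -/

section HopfMonoid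

variable {U : Type u} (K : Type v) [Field K]

/-- The vector space `HG[V]` with basis the hypergraphs over `V`. -/
abbrev HG (V : Finset U) : Type (max u v) := Hypergraph V →₀ K

variable {K} in
/-- A hypergraph as a basis vector of `HG[V]`. -/
abbrev basisVec {V : Finset U} (h : Hypergraph V) : HG K V := Finsupp.single h 1

/-- The identification of `HG[V]` with `HG[W]` when `V = W`. -/
def congrHG {V W : Finset U} (hVW : V = W) : HG K V →ₗ[K] HG K W :=
  Finsupp.lmapDomain K K (fun h => h.copy hVW)

variable [DecidableEq U]

/-- The product `HG[V] ⊗ HG[W] → HG[V ⊔ W]`, the linear extension of disjoint union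
(of interest when `V` and `W` are disjoint). -/
def mu (V W : Finset U) : HG K V ⊗[K] HG K W →ₗ[K] HG K (V ∪ W) :=
  Finsupp.lmapDomain K K (fun p : Hypergraph V × Hypergraph W => p.1.union p.2) ∘ₗ
    (finsuppTensorFinsupp' K (Hypergraph V) (Hypergraph W)).toLinearMap

/-- The coproduct `HG[V ⊔ W] → HG[V] ⊗ HG[W]`, `h ↦ h|_V ⊗ h/_V`
(of interest when `V` and `W` are disjoint). -/
def delta (V W : Finset U) : HG K (V ∪ W) →ₗ[K] HG K V ⊗[K] HG K W :=
  Finsupp.linearCombination K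
    (fun h : Hypergraph (V ∪ W) => basisVec (K := K) h.restrict ⊗ₜ[K] basisVec (K := K) h.contract)

/-- The union `V₁ ∪ ⋯ ∪ Vₙ` of a sequence of finite sets, bracketed to the right. -/
def unionParts : {n : ℕ} → (Fin n → Finset U) → Finset U
  | 0, _ => ∅
  | _ + 1, D => D 0 ∪ unionParts (fun i => D i.succ)

theorem mem_unionParts {n : ℕ} (D : Fin n → Finset U) (x : U) :
    x ∈ unionParts D ↔ ∃ i, x ∈ D i := by
  induction n with
  | zero => simp [unionParts]
  | succ n ih => simp [unionParts, ih, Fin.exists_fin_succ]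

/-- The tensor product `HG[V₁] ⊗ ⋯ ⊗ HG[Vₙ]`, bracketed to the right and ending with the
one-dimensional space `HG[∅]`, the unit of the tensor product. -/
def tensorParts : {n : ℕ} → (Fin n → Finset U) → ModuleCat.{max u v} K
  | 0, _ => ModuleCat.of K (HG K (∅ : Finset U))
  | _ + 1, D => ModuleCat.of K (HG K (D 0) ⊗[K] tensorParts (fun i => D i.succ))

/-- The iterated product `μ_{V₁,…,Vₙ} : HG[V₁] ⊗ ⋯ ⊗ HG[Vₙ] → HG[V₁ ⊔ ⋯ ⊔ Vₙ]`. -/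
def iterMu : {n : ℕ} → (D : Fin n → Finset U) → tensorParts K D →ₗ[K] HG K (unionParts D)
  | 0, _ => (LinearMap.id : HG K (∅ : Finset U) →ₗ[K] HG K (∅ : Finset U))
  | _ + 1, D =>
    mu K (D 0) (unionParts (fun i => D i.succ)) ∘ₗ
      (iterMu (fun i => D i.succ)).lTensor (HG K (D 0))

/-- The iterated coproduct `Δ_{V₁,…,Vₙ} : HG[V₁ ⊔ ⋯ ⊔ Vₙ] → HG[V₁] ⊗ ⋯ ⊗ HG[Vₙ]`. -/
def iterDelta : {n : ℕ} → (D : Fin n → Finset U) → HG K (unionParts D) →ₗ[K] tensorParts K D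
  | 0, _ => (LinearMap.id : HG K (∅ : Finset U) →ₗ[K] HG K (∅ : Finset U))
  | _ + 1, D =>
    (iterDelta (fun i => D i.succ)).lTensor (HG K (D 0)) ∘ₗ
      delta K (D 0) (unionParts (fun i => D i.succ))

/-- A character of `HG`: linear forms `ζ_V : HG[V] → K`, compatible with the product and sending
the unit to the unit. -/
structure Character (U : Type u) [DecidableEq U] (K : Type v) [Field K] where
  form : (V : Finset U) → HG K V →ₗ[K] K
  map_mul : ∀ V W : Finset U, Disjoint V W → ∀ (x : HG K V) (y : HG K W),
    form (V ∪ W) (mu K V W (x ⊗ₜ[K] y)) = form V x * form W y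
  map_one : form ∅ (basisVec Hypergraph.empty) = 1

/-- A decomposition of `V` of length `n`: a sequence of `n` pairwise disjoint, possibly empty,
subsets with union `V`. -/
@[ext]
structure Decomposition (V : Finset U) (n : ℕ) where
  parts : Fin n → Finset U
  disjoint : ∀ i j, i ≠ j → Disjoint (parts i) (parts j)
  union_eq : unionParts parts = V

instance (V : Finset U) (n : ℕ) : Fintype (Decomposition V n) :=
  Fintype.ofInjective
    (fun D i => (⟨D.parts i, Finset.mem_powerset.2 fun x hx =>
      D.union_eq ▸ (mem_unionParts D.parts x).2 ⟨i, hx⟩⟩ : V.powerset))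
    (fun _ _ h => Decomposition.ext (funext fun i => congrArg Subtype.val (congrFun h i)))

variable {K}

/-- The value of `ζ` on a hypergraph. -/
def Character.eval (ζ : Character U K) {V : Finset U} (h : Hypergraph V) : K :=
  ζ.form V (basisVec h)

/-- The invariant
`χ^ζ_V(x)(n) = ∑_{V = V₁ ⊔ ⋯ ⊔ Vₙ} ζ_V (μ_{V₁,…,Vₙ} (Δ_{V₁,…,Vₙ} x))`, for `n` a natural number. -/
def chi (ζ : Character U K) {V : Finset U} (x : HG K V) (n : ℕ) : K :=
  ∑ D : Decomposition V n,
    ζ.form V (congrHG K D.union_eq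
      (iterMu K D.parts (iterDelta K D.parts (congrHG K D.union_eq.symm x))))

end HopfMonoid

/-! ### Connected components, characteristic functions and odd characters -/

namespace Hypergraph

variable {U : Type u} {V : Finset U}

/-- Two distinct vertices are adjacent when some edge contains both. -/
def adjGraph (h : Hypergraph V) : SimpleGraph V where
  Adj v w := v ≠ w ∧ ∃ e ∈ h.edges, v.1 ∈ e ∧ w.1 ∈ e
  symm := ⟨fun _ _ hvw => ⟨hvw.1.symm, hvw.2.imp fun _ he => ⟨he.1, he.2.2, he.2.1⟩⟩⟩
  loopless := ⟨fun _ hv => hv.1 rfl⟩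

/-- The connected components of a hypergraph; a vertex in no edge is a component. -/
abbrev Component (h : Hypergraph V) : Type u := h.adjGraph.ConnectedComponent

/-- The number of connected components. -/
def cc (h : Hypergraph V) : ℕ := Nat.card h.Component

end Hypergraph

namespace Character

variable {U : Type u} [DecidableEq U] {K : Type v} [Field K]

/-- The character only takes the values `0` and `1` on hypergraphs. -/
def IsCharacteristic (ζ : Character U K) : Prop :=
  ∀ (V : Finset U) (h : Hypergraph V), ζ.eval h = 0 ∨ ζ.eval h = 1

/-- The character vanishes on every hypergraph that has a connected component with an even number
of vertices. -/
def IsOdd (ζ : Character U K) : Prop :=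
  ∀ (V : Finset U) (h : Hypergraph V), (∃ C : h.Component, Even C.supp.ncard) → ζ.eval h = 0

end Character

/-! ### Orientations and colorings -/

section Orientations

variable {U : Type u} [DecidableEq U] {V : Finset U}

/-- The edges of `h`, each repeated according to its multiplicity; the underlying set of vertices
of `e : h.Edge` is `e.1`. -/
abbrev Hypergraph.Edge (h : Hypergraph V) : Type u := h.edges.ToType

/-- An admissible orientation: a nonempty subset `f(e) ⊆ e` for each edge `e`. -/
@[ext]
structure Orientation (h : Hypergraph V) where
  head : h.Edge → Finset U
  head_nonempty : ∀ e, (head e).Nonempty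
  head_subset : ∀ e, head e ⊆ e.1

namespace Orientation

variable {h : Hypergraph V}

open Classical in
instance : Fintype (Orientation h) :=
  Fintype.ofInjective
    (fun f e => (⟨f.head e, Finset.mem_powerset.2 ((f.head_subset e).trans
      (h.subset_of_mem e.1 Multiset.coe_mem))⟩ : V.powerset))
    (fun _ _ hfg => Orientation.ext (funext fun e => congrArg Subtype.val (congrFun hfg e)))

/-- The set `f_s(e) = e \ f(e)`. -/
def tail (f : Orientation h) (e : h.Edge) : Finset U := e.1 \ f.head e

/-- The hypergraph `f(h) = {f(e) | e ∈ h}` over `V`, a multiset indexed by the edges of `h`. -/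
def image (f : Orientation h) : Hypergraph V where
  edges := (Finset.univ : Finset h.Edge).val.map f.head
  nonempty_of_mem s hs := by
    obtain ⟨e, _, rfl⟩ := Multiset.mem_map.1 hs
    exact f.head_nonempty e
  subset_of_mem s hs := by
    obtain ⟨e, _, rfl⟩ := Multiset.mem_map.1 hs
    exact (f.head_subset e).trans (h.subset_of_mem e.1 Multiset.coe_mem)

/-- The orientation is acyclic: there are no distinct edges `e₀, …, eₖ` with
`f(eᵢ) ∩ f_s(eᵢ₊₁) ≠ ∅` or `∅ ⊊ f(eᵢ) ∩ eᵢ₊₁ ⊊ f(eᵢ₊₁)` for all `i < k`, and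
`f(eₖ) ∩ f_s(e₀) ≠ ∅`. -/
def IsAcyclic (f : Orientation h) : Prop :=
  ¬ ∃ (k : ℕ) (e : Fin (k + 1) → h.Edge), Function.Injective e ∧
    (∀ i : Fin k, (f.head (e i.castSucc) ∩ f.tail (e i.succ)).Nonempty ∨
      (∅ ⊂ f.head (e i.castSucc) ∩ (e i.succ).1 ∧
        f.head (e i.castSucc) ∩ (e i.succ).1 ⊂ f.head (e i.succ))) ∧
    (f.head (e (Fin.last k)) ∩ f.tail (e 0)).Nonempty

/-- A coloring `c` is compatible with `f` if, for each edge `e`, the elements of `f(e)` have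
maximal color in `e`. -/
def Compatible {n : ℕ} (f : Orientation h) (c : V → Fin n) : Prop :=
  ∀ (e : h.Edge) (v w : V), v.1 ∈ f.head e → w.1 ∈ e.1 → c w ≤ c v

end Orientation

open Classical in
/-- The set of acyclic orientations of `h`. -/
def acyclicOrientations (h : Hypergraph V) : Finset (Orientation h) :=
  Finset.univ.filter fun f => f.IsAcyclic

open Classical in
/-- The set of colorings of `V` with `n` colors that are compatible with `f`. -/
def compatibleColorings {h : Hypergraph V} (f : Orientation h) (n : ℕ) : Finset (V → Fin n) :=
  Finset.univ.filter fun c => f.Compatible c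

open Classical in
/-- The set of acyclic `ζ`-orientations of `h`, those with `ζ(f(h)) ≠ 0`. -/
def acyclicZetaOrientations {K : Type v} [Field K] (ζ : Character U K) (h : Hypergraph V) :
    Finset (Orientation h) :=
  (acyclicOrientations h).filter fun f => ζ.eval f.image ≠ 0

open Classical in
/-- The compatible pairs of an acyclic `ζ`-orientation of `h` and a coloring with `n` colors. -/
def compatiblePairs {K : Type v} [Field K] (ζ : Character U K) (h : Hypergraph V) (n : ℕ) :
    Finset (Orientation h × (V → Fin n)) :=
  (acyclicZetaOrientations ζ h ×ˢ Finset.univ).filter fun p => p.1.Compatible p.2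

end Orientations

end HypergraphMonoid

end

/-! On a basis vector, the iterated coproduct followed by the iterated product keeps from each edge
its intersection with the last part meeting it. If the decomposition is read as a coloring `c`, this
is the set of vertices of maximal color in the edge. So `chi` sums over all colorings the value of
`ζ` on the image of `maxOrientation h c` (`chi_basisVec_eq_sum`). These orientations are acyclic,
and the sum is grouped by orientation.

Fix an acyclic `f`. The colorings with `maxOrientation h c = f` are constant on the components of
`f.image` and amount to strictly increasing maps for `componentRel` on components; the compatible
colorings amount to the weakly increasing ones. Acyclicity rules out cycles of `componentRel`
(`IsAcyclic.not_transGen_componentRel`). Stanley's reciprocity (`exists_orderPolynomial`) then gives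
a polynomial counting strict maps at `n` and, up to the sign `(-1) ^ cc`, weak maps at `-n`. The
required polynomial is the sum of these, weighted by `ζ`.

If `ζ` is odd and nonzero on a hypergraph, all components have odd size, so `cc` and `|V|` have the
same parity and all signs agree. -/

namespace HypergraphMonoid

universe u v

/-! ### Reciprocity for order polynomials -/

section OrderPolynomial

/-- Discrete integration, monomial by monomial: the Bernoulli polynomial of degree `n + 1` has
forward difference `(n + 1) x ^ n`, and characteristic zero allows division by `n + 1`. -/
theorem exists_polynomial_eval_add_one_sub {K : Type*} [Field K] [CharZero K]
    (q : Polynomial K) (a : K) :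
    ∃ p : Polynomial K, p.eval 0 = a ∧ ∀ x, p.eval (x + 1) = p.eval x + q.eval x := by
  suffices H : ∃ p : Polynomial K, ∀ x, p.eval (x + 1) = p.eval x + q.eval x by
    obtain ⟨p, hp⟩ := H
    refine ⟨p + Polynomial.C (a - p.eval 0), by simp, fun x => ?_⟩
    simp only [Polynomial.eval_add, Polynomial.eval_C, hp]
    ring
  induction q using Polynomial.induction_on' with
  | add q₁ q₂ h₁ h₂ =>
    obtain ⟨p₁, h₁⟩ := h₁
    obtain ⟨p₂, h₂⟩ := h₂
    refine ⟨p₁ + p₂, fun x => ?_⟩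
    simp only [Polynomial.eval_add, h₁, h₂]
    ring
  | monomial n b =>
    have hn : (n + 1 : K) ≠ 0 := by exact_mod_cast n.succ_ne_zero
    refine ⟨Polynomial.C (b / (n + 1)) *
      (Polynomial.bernoulli (n + 1)).map (algebraMap ℚ K), fun x => ?_⟩
    have h := congrArg (fun p : Polynomial ℚ => (p.map (algebraMap ℚ K)).eval x)
      (Polynomial.bernoulli_comp_one_add_X (n + 1))
    simp only [Polynomial.map_comp, Polynomial.eval_comp, Polynomial.map_add,
      Polynomial.eval_add, Polynomial.map_one, Polynomial.map_X, Polynomial.eval_X,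
      Polynomial.eval_one, Polynomial.map_pow,
      Polynomial.eval_pow, nsmul_eq_mul, Polynomial.map_mul, Polynomial.eval_mul,
      Polynomial.map_natCast, Polynomial.eval_natCast] at h
    rw [add_comm x 1, Polynomial.eval_mul, h]
    simp only [Polynomial.eval_mul, Polynomial.eval_C, Polynomial.eval_monomial,
      Nat.add_sub_cancel]
    push_cast
    field_simp

variable {X : Type u} [Fintype X] [DecidableEq X] (r : X → X → Prop)

open Classical in
/-- The maps `S → {0, …, n - 1}`, extended by `0`, that are weakly increasing for `r`. -/
noncomputable def weakMaps (S : Finset X) (n : ℕ) : Finset (X → ℕ) :=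
  (Fintype.piFinset fun x => if x ∈ S then Finset.range n else {0}).filter
    fun c => ∀ x ∈ S, ∀ y ∈ S, r x y → c x ≤ c y

open Classical in
/-- The maps `S → {0, …, n - 1}`, extended by `0`, that are strictly increasing for `r`. -/
noncomputable def strictMaps (S : Finset X) (n : ℕ) : Finset (X → ℕ) :=
  (Fintype.piFinset fun x => if x ∈ S then Finset.range n else {0}).filter
    fun c => ∀ x ∈ S, ∀ y ∈ S, r x y → c x < c y

open Classical in
/-- The elements of `S` without a successor in `S`. -/
noncomputable def maximalElements (S : Finset X) : Finset X :=
  S.filter fun x => ∀ y ∈ S, ¬ r x y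

variable {r}

theorem mem_piFinset_range {S : Finset X} {n : ℕ} {c : X → ℕ} :
    (c ∈ Fintype.piFinset fun x => if x ∈ S then Finset.range n else {0}) ↔
      (∀ x ∈ S, c x < n) ∧ ∀ x ∉ S, c x = 0 := by
  rw [Fintype.mem_piFinset]
  constructor
  · intro h
    refine ⟨fun x hx => ?_, fun x hx => ?_⟩
    · simpa [hx] using h x
    · simpa [hx] using h x
  · rintro ⟨h₁, h₂⟩ x
    by_cases hx : x ∈ S
    · simpa [hx] using h₁ x hx
    · simpa [hx] using h₂ x hx

theorem mem_weakMaps {S : Finset X} {n : ℕ} {c : X → ℕ} :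
    c ∈ weakMaps r S n ↔ ((∀ x ∈ S, c x < n) ∧ ∀ x ∉ S, c x = 0) ∧
      ∀ x ∈ S, ∀ y ∈ S, r x y → c x ≤ c y := by
  classical rw [weakMaps, Finset.mem_filter, mem_piFinset_range]

theorem mem_strictMaps {S : Finset X} {n : ℕ} {c : X → ℕ} :
    c ∈ strictMaps r S n ↔ ((∀ x ∈ S, c x < n) ∧ ∀ x ∉ S, c x = 0) ∧
      ∀ x ∈ S, ∀ y ∈ S, r x y → c x < c y := by
  classical rw [strictMaps, Finset.mem_filter, mem_piFinset_range]

theorem mem_maximalElements {S : Finset X} {x : X} :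
    x ∈ maximalElements r S ↔ x ∈ S ∧ ∀ y ∈ S, ¬ r x y := by
  simp [maximalElements]

theorem maximalElements_subset (S : Finset X) : maximalElements r S ⊆ S :=
  fun _ hx => (mem_maximalElements.1 hx).1

/-- Sort the maps by the set `A` on which the top value `n` is taken. By strictness no element of
`A` has a successor in `S`, and off `A` only `n` values remain. -/
theorem card_strictMaps_succ (S : Finset X) (n : ℕ) :
    (strictMaps r S (n + 1)).card =
      ∑ A ∈ (maximalElements r S).powerset, (strictMaps r (S \ A) n).card := by
  rw [Finset.card_eq_sum_card_fiberwise (f := fun c => S.filter fun x => c x = n)]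
  · refine Finset.sum_congr rfl fun A hA => ?_
    have hA := Finset.mem_powerset.1 hA
    have hAS := hA.trans (maximalElements_subset S)
    have hmax : ∀ x ∈ A, ∀ y ∈ S, ¬ r x y := fun x hx => (mem_maximalElements.1 (hA hx)).2
    refine Finset.card_nbij' (fun c x => if x ∈ A then 0 else c x)
      (fun c x => if x ∈ A then n else c x) ?_ ?_ ?_ ?_
    · intro c hc
      simp only [Finset.coe_filter, Set.mem_ofPred_eq, mem_strictMaps] at hc
      obtain ⟨⟨⟨h₁, h₂⟩, h₃⟩, rfl⟩ := hc
      simp only [Finset.mem_coe, mem_strictMaps, Finset.mem_sdiff, Finset.mem_filter]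
      refine ⟨⟨fun x hx => ?_, fun x hx => ?_⟩, fun x hx y hy hxy => ?_⟩
      · have := h₁ x hx.1
        grind
      · grind
      · have := h₃ x hx.1 y hy.1 hxy
        grind
    · intro c hc
      simp only [Finset.mem_coe, mem_strictMaps, Finset.mem_sdiff] at hc
      obtain ⟨⟨h₁, h₂⟩, h₃⟩ := hc
      simp only [Finset.coe_filter, Set.mem_ofPred_eq, mem_strictMaps]
      refine ⟨⟨⟨fun x hx => ?_, fun x hx => ?_⟩, fun x hx y hy hxy => ?_⟩, ?_⟩
      · have := h₁ x
        grind
      · have := h₂ x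
        have := @hAS x
        grind
      · have := h₃ x
        have := h₁ x
        have := hmax x
        grind
      · ext x
        have := h₁ x
        have := @hAS x
        grind
    · intro c hc
      simp only [Finset.coe_filter, Set.mem_ofPred_eq, mem_strictMaps] at hc
      obtain ⟨⟨⟨h₁, h₂⟩, h₃⟩, rfl⟩ := hc
      funext x
      grind
    · intro c hc
      simp only [Finset.mem_coe, mem_strictMaps, Finset.mem_sdiff] at hc
      obtain ⟨⟨h₁, h₂⟩, h₃⟩ := hc
      funext x
      have := h₂ x
      grind
  · intro c hc
    simp only [Finset.mem_coe, mem_strictMaps] at hc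
    simp only [Finset.coe_powerset, Set.mem_preimage, Set.mem_powerset_iff, Finset.coe_subset]
    intro x hx
    simp only [Finset.mem_filter] at hx
    refine mem_maximalElements.2 ⟨hx.1, fun y hy hxy => ?_⟩
    have := hc.1.1 y hy
    have := hc.2 x hx.1 y hy hxy
    omega

/-- Elements of `A` have no successor in `S`, so extending a map by the top value `n` on `A` creates
no violation. -/
theorem card_weakMaps_sdiff {S A : Finset X} (hA : A ⊆ maximalElements r S) (n : ℕ) :
    (weakMaps r (S \ A) (n + 1)).card =
      ((weakMaps r S (n + 1)).filter fun c => ∀ x ∈ A, c x = n).card := by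
  have hAS := hA.trans (maximalElements_subset S)
  have hmax : ∀ x ∈ A, ∀ y ∈ S, ¬ r x y := fun x hx => (mem_maximalElements.1 (hA hx)).2
  refine Finset.card_nbij' (fun c x => if x ∈ A then n else c x)
    (fun c x => if x ∈ A then 0 else c x) ?_ ?_ ?_ ?_
  · intro c hc
    simp only [Finset.mem_coe, mem_weakMaps, Finset.mem_sdiff] at hc
    obtain ⟨⟨h₁, h₂⟩, h₃⟩ := hc
    simp only [Finset.coe_filter, Set.mem_ofPred_eq, mem_weakMaps]
    refine ⟨⟨⟨fun x hx => ?_, fun x hx => ?_⟩, fun x hx y hy hxy => ?_⟩, ?_⟩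
    · have := h₁ x
      grind
    · have := h₂ x
      have := @hAS x
      grind
    · have := h₃ x
      have := h₁ x
      have := hmax x
      grind
    · grind
  · intro c hc
    simp only [Finset.coe_filter, Set.mem_ofPred_eq, mem_weakMaps] at hc
    obtain ⟨⟨⟨h₁, h₂⟩, h₃⟩, h₄⟩ := hc
    simp only [Finset.mem_coe, mem_weakMaps, Finset.mem_sdiff]
    refine ⟨⟨fun x hx => ?_, fun x hx => ?_⟩, fun x hx y hy hxy => ?_⟩
    · have := h₁ x hx.1
      grind
    · grind
    · have := h₃ x hx.1 y hy.1 hxy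
      grind
  · intro c hc
    simp only [Finset.mem_coe, mem_weakMaps, Finset.mem_sdiff] at hc
    obtain ⟨⟨h₁, h₂⟩, h₃⟩ := hc
    funext x
    have := h₂ x
    grind
  · intro c hc
    simp only [Finset.coe_filter, Set.mem_ofPred_eq, mem_weakMaps] at hc
    obtain ⟨⟨⟨h₁, h₂⟩, h₃⟩, h₄⟩ := hc
    funext x
    grind

/-- Inclusion–exclusion over the maximal elements sent to the top value `n`: it leaves the maps
sending no maximal element to `n`, and these avoid `n` altogether. -/
theorem card_weakMaps_eq_sum
    (hr : ∀ T : Finset X, T.Nonempty → ∃ x ∈ T, ∀ y ∈ T, ¬ r x y) (S : Finset X) (n : ℕ) :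
    ((weakMaps r S n).card : ℤ) =
      ∑ A ∈ (maximalElements r S).powerset,
        (-1) ^ A.card * ((weakMaps r (S \ A) (n + 1)).card : ℤ) := by
  classical
  have h₁ : ∀ A ∈ (maximalElements r S).powerset,
      (-1) ^ A.card * ((weakMaps r (S \ A) (n + 1)).card : ℤ) =
        ∑ c ∈ weakMaps r S (n + 1), if ∀ x ∈ A, c x = n then (-1) ^ A.card else 0 := by
    intro A hA
    rw [card_weakMaps_sdiff (Finset.mem_powerset.1 hA), ← Finset.sum_filter, Finset.sum_const,
      nsmul_eq_mul, mul_comm]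
  rw [Finset.sum_congr rfl h₁, Finset.sum_comm]
  have h₂ : ∀ c ∈ weakMaps r S (n + 1),
      (∑ A ∈ (maximalElements r S).powerset, if ∀ x ∈ A, c x = n then (-1 : ℤ) ^ A.card else 0) =
        if (maximalElements r S).filter (fun x => c x = n) = ∅ then 1 else 0 := by
    intro c _
    -- For fixed `c`, the sets `A` that contribute are the subsets of the set of maximal elements
    -- with value `n`; their alternating sum vanishes unless that set is empty.
    rw [← Finset.sum_powerset_neg_one_pow_card, ← Finset.sum_filter]
    refine Finset.sum_congr ?_ fun _ _ => rfl
    ext A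
    simp only [Finset.mem_filter, Finset.mem_powerset, Finset.subset_iff]
    grind
  rw [Finset.sum_congr rfl h₂, ← Finset.sum_filter, Finset.sum_const, nsmul_eq_mul, mul_one]
  congr 2
  ext c
  simp only [Finset.mem_filter, mem_weakMaps, Finset.filter_eq_empty_iff]
  constructor
  · rintro ⟨⟨h₁, h₂⟩, h₃⟩
    refine ⟨⟨⟨fun x hx => (h₁ x hx).trans n.lt_succ_self, h₂⟩, h₃⟩, fun x hx => ?_⟩
    exact (h₁ x (maximalElements_subset S hx)).ne
  · rintro ⟨⟨⟨h₁, h₂⟩, h₃⟩, h₄⟩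
    refine ⟨⟨fun x hx => ?_, h₂⟩, h₃⟩
    by_contra hlt
    -- A maximal element of the top fibre is maximal in `S`, because by monotonicity any successor
    -- would lie in the fibre too.
    obtain ⟨z, hz, hzmax⟩ := hr (S.filter fun x => c x = n)
      ⟨x, Finset.mem_filter.2 ⟨hx, by have := h₁ x hx; omega⟩⟩
    obtain ⟨hzS, hzn⟩ := Finset.mem_filter.1 hz
    refine h₄ (mem_maximalElements.2 ⟨hzS, fun y hy hzy => ?_⟩) hzn
    refine hzmax y (Finset.mem_filter.2 ⟨hy, ?_⟩) hzy
    have := h₁ y hy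
    have := h₃ z hzS y hy hzy
    omega

/-- Reciprocity between strictly increasing and weakly increasing maps. -/
theorem exists_orderPolynomial (K : Type*) [Field K] [CharZero K]
    (hr : ∀ T : Finset X, T.Nonempty → ∃ x ∈ T, ∀ y ∈ T, ¬ r x y) (S : Finset X) :
    ∃ p : Polynomial K, ∀ n : ℕ, p.eval (n : K) = (strictMaps r S n).card ∧
      p.eval (-(n : K)) = (-1) ^ S.card * ((weakMaps r S n).card : K) := by
  induction S using Finset.strongInduction with
  | H S ih =>
    have hsub : ∀ A ∈ (maximalElements r S).powerset.erase ∅, S \ A ⊂ S := by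
      intro A hA
      obtain ⟨hA₀, hA⟩ := Finset.mem_erase.1 hA
      have hAS := (Finset.mem_powerset.1 hA).trans (maximalElements_subset S)
      exact Finset.sdiff_ssubset hAS (Finset.nonempty_iff_ne_empty.2 hA₀)
    choose! P hP using fun A hA => ih (S \ A) (hsub A hA)
    -- The nonempty `A` in `card_strictMaps_succ` prescribe the forward difference of `p`; the term
    -- `A = ∅` is the count at `n` itself.
    obtain ⟨p, hp₀, hp⟩ := exists_polynomial_eval_add_one_sub
      (∑ A ∈ (maximalElements r S).powerset.erase ∅, P A) ((strictMaps r S 0).card : K)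
    have hmem : ∅ ∈ (maximalElements r S).powerset := Finset.empty_mem_powerset _
    refine ⟨p, fun n => ⟨?_, ?_⟩⟩
    · induction n with
      | zero => simpa using hp₀
      | succ n ihn =>
        push_cast
        rw [hp, ihn, card_strictMaps_succ, ← Finset.add_sum_erase _ _ hmem, Finset.sdiff_empty,
          Polynomial.eval_finsetSum]
        push_cast
        rw [Finset.sum_congr rfl fun A hA => (hP A hA n).1]
    · induction n with
      | zero =>
        rw [Nat.cast_zero, neg_zero, hp₀]
        rcases S.eq_empty_or_nonempty with rfl | ⟨x, hx⟩
        · simp [strictMaps, weakMaps]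
        · have h₁ : strictMaps r S 0 = ∅ := Finset.eq_empty_of_forall_notMem fun c hc =>
            absurd ((mem_strictMaps.1 hc).1.1 x hx) (Nat.not_lt_zero _)
          have h₂ : weakMaps r S 0 = ∅ := Finset.eq_empty_of_forall_notMem fun c hc =>
            absurd ((mem_weakMaps.1 hc).1.1 x hx) (Nat.not_lt_zero _)
          simp [h₁, h₂]
      | succ n ihn =>
        -- The same difference equation, run backwards from `-n` to `-(n + 1)`, matches
        -- `card_weakMaps_eq_sum` once the signs of `A` and `S \ A` are combined.
        have h := hp (-((n + 1 : ℕ) : K))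
        rw [show -((n + 1 : ℕ) : K) + 1 = -(n : K) by push_cast; ring, ihn,
          Polynomial.eval_finsetSum, Finset.sum_congr rfl fun A hA => (hP A hA (n + 1)).2] at h
        have hw := congrArg (Int.cast : ℤ → K) (card_weakMaps_eq_sum hr S n)
        push_cast at hw
        rw [← Finset.add_sum_erase _ _ hmem, Finset.sdiff_empty, Finset.card_empty, pow_zero,
          one_mul] at hw
        rw [hw, mul_add, Finset.mul_sum] at h
        have hs : ∀ A ∈ (maximalElements r S).powerset.erase ∅,
            (-1 : K) ^ S.card * ((-1) ^ A.card * ((weakMaps r (S \ A) (n + 1)).card : K)) =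
              (-1) ^ (S \ A).card * ((weakMaps r (S \ A) (n + 1)).card : K) := by
          intro A hA
          have hAS := (Finset.mem_powerset.1 (Finset.mem_of_mem_erase hA)).trans
            (maximalElements_subset S)
          rw [← Finset.card_sdiff_add_card_eq_card hAS, pow_add, mul_assoc, ← mul_assoc (_ ^ A.card),
            ← mul_pow]
          simp
        rw [Finset.sum_congr rfl hs] at h
        exact (add_right_cancel h).symm

end OrderPolynomial

/-! ### The invariant as a sum over colorings -/

section Colorings

variable {U : Type u} {K : Type v} [Field K]

theorem congrHG_basisVec {V W : Finset U} (hVW : V = W) (h : Hypergraph V) :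
    congrHG K hVW (basisVec h) = basisVec (h.copy hVW) := by
  simp [congrHG, Finsupp.lmapDomain_apply, Finsupp.mapDomain_single]

variable [DecidableEq U]

theorem mu_basisVec {V W : Finset U} (h : Hypergraph V) (k : Hypergraph W) :
    mu K V W (basisVec h ⊗ₜ[K] basisVec k) = basisVec (h.union k) := by
  simp [mu, Finsupp.lmapDomain_apply, Finsupp.mapDomain_single]

theorem delta_basisVec {V W : Finset U} (h : Hypergraph (V ∪ W)) :
    delta K V W (basisVec h) = basisVec h.restrict ⊗ₜ[K] basisVec h.contract := by
  simp [delta]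

/-- What remains of `e` after contracting the parts successively, up to the last part that
meets `e`. -/
def topPart : {n : ℕ} → (Fin n → Finset U) → Finset U → Finset U
  | 0, _, e => e
  | _ + 1, D, e => if e ⊆ D 0 then e else topPart (fun i => D i.succ) (e \ D 0)

/-- Edges inside the first part go to the restriction and stay fixed; the others lose that part and
pass to the contraction, where the induction acts. -/
theorem exists_iterMu_iterDelta {n : ℕ} (D : Fin n → Finset U) (h : Hypergraph (unionParts D)) :
    ∃ k : Hypergraph (unionParts D), k.edges = h.edges.map (topPart D) ∧
      iterMu K D (iterDelta K D (basisVec h)) = basisVec k := by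
  induction n with
  | zero => exact ⟨h, by simp [topPart], rfl⟩
  | succ n ih =>
    change Hypergraph (D 0 ∪ unionParts fun i => D i.succ) at h
    obtain ⟨k, hk, hk'⟩ := ih (fun i => D i.succ) h.contract
    refine ⟨h.restrict.union k, ?_, ?_⟩
    · change h.edges.filter (fun e => e ⊆ D 0) + k.edges = _
      rw [hk]
      change _ + (((h.edges.filter fun e => ¬ e ⊆ D 0)).map (fun e => e \ D 0)).map _ = _
      conv_rhs => rw [← Multiset.filter_add_not (fun e => e ⊆ D 0) h.edges, Multiset.map_add]
      rw [Multiset.map_map]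
      congr 1
      · conv_lhs => rw [← Multiset.map_id (Multiset.filter (fun e => e ⊆ D 0) h.edges)]
        refine Multiset.map_congr rfl fun e he => ?_
        simp [topPart, (Multiset.mem_filter.1 he).2]
      · refine Multiset.map_congr rfl fun e he => ?_
        simp [topPart, (Multiset.mem_filter.1 he).2]
    · change mu K (D 0) (unionParts fun i => D i.succ)
        ((iterMu K fun i => D i.succ).lTensor (HG K (D 0))
          ((iterDelta K fun i => D i.succ).lTensor (HG K (D 0))
            (delta K (D 0) (unionParts fun i => D i.succ) (basisVec h)))) = _
      rw [delta_basisVec, LinearMap.lTensor_tmul, LinearMap.lTensor_tmul, hk', mu_basisVec]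
      rfl

/-- By disjointness, removing `D 0` does not change how `e` meets the later parts, so the recursion
stops at the last part meeting `e`. -/
theorem topPart_eq_inter {n : ℕ} (D : Fin n → Finset U)
    (hD : ∀ i j, i ≠ j → Disjoint (D i) (D j)) (e : Finset U) (he : e.Nonempty)
    (heD : e ⊆ unionParts D) :
    ∃ i, topPart D e = e ∩ D i ∧ (e ∩ D i).Nonempty ∧ ∀ j, i < j → Disjoint e (D j) := by
  induction n generalizing e with
  | zero => exact absurd (Finset.subset_empty.1 heD) he.ne_empty
  | succ n ih =>
    by_cases h0 : e ⊆ D 0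
    · refine ⟨0, ?_, ?_, fun j hj => ?_⟩
      · simp [topPart, h0, Finset.inter_eq_left.2 h0]
      · rwa [Finset.inter_eq_left.2 h0]
      · exact (hD 0 j hj.ne).mono_left h0
    · have hsd : ∀ j : Fin n, (e \ D 0) ∩ D j.succ = e ∩ D j.succ := by
        intro j
        ext x
        have hx : x ∈ D j.succ → x ∉ D 0 := fun hx =>
          Finset.disjoint_left.1 (hD j.succ 0 (Fin.succ_ne_zero j)) hx
        simp only [Finset.mem_inter, Finset.mem_sdiff]
        tauto
      obtain ⟨i, h₁, h₂, h₃⟩ := ih (fun i => D i.succ)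
        (fun i j hij => hD _ _ fun h => hij (Fin.succ_injective _ h)) (e \ D 0)
        (Finset.sdiff_nonempty.2 h0) (sdiff_le_iff.2 heD)
      rw [hsd] at h₁ h₂
      refine ⟨i.succ, by simp [topPart, h0, h₁], h₂, fun j hj => ?_⟩
      obtain ⟨j, rfl⟩ := Fin.exists_succ_eq.2 (Fin.ne_zero_of_lt hj)
      have := h₃ j (Fin.succ_lt_succ_iff.1 hj)
      rwa [Finset.disjoint_iff_inter_eq_empty, hsd, ← Finset.disjoint_iff_inter_eq_empty] at this

/-! ### Decompositions as colorings, and vertices of maximal color -/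

variable {V : Finset U} {n : ℕ}

/-- The elements of `e` of maximal color. -/
def maxSet (c : V → Fin n) (e : Finset U) : Finset U :=
  (Finset.univ.filter fun v : V => v.1 ∈ e ∧ ∀ w : V, w.1 ∈ e → c w ≤ c v).image Subtype.val

theorem coe_mem_maxSet {c : V → Fin n} {e : Finset U} {v : V} :
    v.1 ∈ maxSet c e ↔ v.1 ∈ e ∧ ∀ w : V, w.1 ∈ e → c w ≤ c v := by
  simp [maxSet]

theorem maxSet_subset_left (c : V → Fin n) (e : Finset U) : maxSet c e ⊆ V := by
  intro x hx
  obtain ⟨v, _, rfl⟩ := Finset.mem_image.1 hx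
  exact v.2

theorem maxSet_subset (c : V → Fin n) (e : Finset U) : maxSet c e ⊆ e := by
  intro x hx
  exact (coe_mem_maxSet (v := ⟨x, maxSet_subset_left c e hx⟩).1 hx).1

theorem maxSet_nonempty (c : V → Fin n) {e : Finset U} (he : e.Nonempty) (heV : e ⊆ V) :
    (maxSet c e).Nonempty := by
  obtain ⟨x, hx⟩ := he
  obtain ⟨v, hv, hmax⟩ := Finset.exists_max_image (Finset.univ.filter fun v : V => v.1 ∈ e) c
    ⟨⟨x, heV hx⟩, by simpa using hx⟩
  simp only [Finset.mem_filter, Finset.mem_univ, true_and] at hv hmax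
  exact ⟨v.1, coe_mem_maxSet.2 ⟨hv, hmax⟩⟩

/-- The orientation of `h` whose heads are the sets of vertices of maximal color. -/
def maxOrientation (h : Hypergraph V) (c : V → Fin n) : Orientation h where
  head e := maxSet c e.1
  head_nonempty _ := maxSet_nonempty c (h.nonempty_of_mem _ Multiset.coe_mem)
    (h.subset_of_mem _ Multiset.coe_mem)
  head_subset e := maxSet_subset c e.1

theorem image_maxOrientation_edges (h : Hypergraph V) (c : V → Fin n) :
    (maxOrientation h c).image.edges = h.edges.map (maxSet c) :=
  Multiset.map_univ h.edges (maxSet c)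

/-- The decomposition of `V` into the color classes of a coloring. -/
def colorClasses (c : V → Fin n) : Decomposition V n where
  parts i := (Finset.univ.filter fun v : V => c v = i).image Subtype.val
  disjoint i j hij := by
    rw [Finset.disjoint_left]
    intro x hx hx'
    obtain ⟨v, hv, rfl⟩ := Finset.mem_image.1 hx
    obtain ⟨w, hw, hvw⟩ := Finset.mem_image.1 hx'
    obtain rfl := Subtype.ext hvw
    exact hij ((Finset.mem_filter.1 hv).2.symm.trans (Finset.mem_filter.1 hw).2)
  union_eq := by
    ext x
    simp [mem_unionParts]

theorem coe_mem_parts_colorClasses {c : V → Fin n} {v : V} {i : Fin n} :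
    v.1 ∈ (colorClasses c).parts i ↔ c v = i := by
  simp [colorClasses]

theorem colorClasses_bijective :
    Function.Bijective (colorClasses : (V → Fin n) → Decomposition V n) := by
  constructor
  · intro c d hcd
    funext v
    have h : v.1 ∈ (colorClasses d).parts (c v) := hcd ▸ coe_mem_parts_colorClasses.2 rfl
    exact (coe_mem_parts_colorClasses.1 h).symm
  · intro D
    have hD : ∀ v : V, ∃ i, v.1 ∈ D.parts i := fun v =>
      (mem_unionParts D.parts v.1).1 ((Finset.ext_iff.1 D.union_eq v.1).2 v.2)
    choose c hc using hD
    refine ⟨c, Decomposition.ext (funext fun i => Finset.ext fun x => ?_)⟩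
    have hsub : ∀ E : Decomposition V n, x ∈ E.parts i → x ∈ V := fun E hx =>
      E.union_eq ▸ (mem_unionParts E.parts x).2 ⟨i, hx⟩
    by_cases hx : x ∈ V
    · lift x to V using hx
      rw [coe_mem_parts_colorClasses]
      constructor
      · rintro rfl
        exact hc x
      · intro hi
        by_contra hne
        exact Finset.disjoint_left.1 (D.disjoint _ _ hne) (hc x) hi
    · exact ⟨fun h => absurd (hsub _ h) hx, fun h => absurd (hsub _ h) hx⟩

/-- The last color class meeting `e` is the one of the largest color occurring in `e`. -/
theorem topPart_colorClasses (c : V → Fin n) {e : Finset U} (he : e.Nonempty) (heV : e ⊆ V) :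
    topPart (colorClasses c).parts e = maxSet c e := by
  obtain ⟨i, h₁, ⟨x, hx⟩, h₃⟩ := topPart_eq_inter _ (colorClasses c).disjoint e he
    (heV.trans_eq (colorClasses c).union_eq.symm)
  have hle : ∀ w : V, w.1 ∈ e → c w ≤ i := by
    intro w hw
    by_contra! hlt
    exact Finset.disjoint_left.1 (h₃ _ hlt) hw (coe_mem_parts_colorClasses.2 rfl)
  obtain ⟨hxe, hxi⟩ := Finset.mem_inter.1 hx
  lift x to V using heV hxe
  rw [coe_mem_parts_colorClasses] at hxi
  rw [h₁]
  ext y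
  by_cases hy : y ∈ V
  · lift y to V using hy
    rw [Finset.mem_inter, coe_mem_parts_colorClasses, coe_mem_maxSet]
    refine and_congr_right fun hye => ⟨?_, fun h => le_antisymm (hle y hye) (hxi ▸ h x hxe)⟩
    rintro rfl
    exact hle
  · exact ⟨fun h => absurd (heV (Finset.mem_inter.1 h).1) hy,
      fun h => absurd (maxSet_subset_left _ _ h) hy⟩

theorem chi_basisVec_eq_sum (ζ : Character U K) (h : Hypergraph V) (n : ℕ) :
    chi ζ (basisVec h) n = ∑ c : V → Fin n, ζ.eval (maxOrientation h c).image := by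
  rw [chi, ← colorClasses_bijective.sum_comp]
  refine Finset.sum_congr rfl fun c _ => ?_
  rw [congrHG_basisVec]
  obtain ⟨k, hk, hk'⟩ := exists_iterMu_iterDelta (K := K) (colorClasses c).parts
    (h.copy (colorClasses c).union_eq.symm)
  rw [hk', congrHG_basisVec, Character.eval]
  congr 2
  refine Hypergraph.ext ?_
  rw [image_maxOrientation_edges]
  refine hk.trans (Multiset.map_congr rfl fun e he => ?_)
  exact topPart_colorClasses c (h.nonempty_of_mem e he) (h.subset_of_mem e he)

end Colorings

/-! ### Acyclic orientations and the components of the image -/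

/-- Loops are cut out of the chain. This is needed because acyclicity only forbids sequences of
distinct edges. -/
theorem exists_injective_chain {α : Type*} {Q : α → α → Prop} {a b : α}
    (h : Relation.ReflTransGen Q a b) :
    ∃ (k : ℕ) (e : Fin (k + 1) → α), Function.Injective e ∧ e 0 = a ∧ e (Fin.last k) = b ∧
      ∀ i : Fin k, Q (e i.castSucc) (e i.succ) := by
  induction h using Relation.ReflTransGen.head_induction_on with
  | refl => exact ⟨0, fun _ => b, fun x y _ => Subsingleton.elim (α := Fin 1) x y, rfl, rfl, Fin.elim0⟩
  | @head a c hac _ ih =>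
    obtain ⟨k, e, he, rfl, hlast, hQ⟩ := ih
    by_cases ha : a ∈ Set.range e
    · obtain ⟨j, rfl⟩ := ha
      -- The new starting point already occurs as `e j`, so the chain is restarted there.
      refine ⟨k - j, fun i => e ⟨j + i, by omega⟩, ?_, ?_, ?_, ?_⟩
      · intro x y hxy
        have := congrArg Fin.val (he hxy)
        exact Fin.ext (by simpa using this)
      · simp
      · rw [← hlast]
        refine congrArg e (Fin.ext ?_)
        simp only [Fin.val_last]
        omega
      · intro i
        exact hQ ⟨j + i, by omega⟩
    · refine ⟨k + 1, Fin.cons a e, Fin.cons_injective_iff.2 ⟨ha, he⟩, rfl, ?_, ?_⟩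
      · rw [← hlast, ← Fin.succ_last, Fin.cons_succ]
      · intro i
        cases i using Fin.cases with
        | zero => simpa using hac
        | succ i => simpa [← Fin.succ_castSucc] using hQ i

namespace Orientation

variable {U : Type u} [DecidableEq U] {V : Finset U} {h : Hypergraph V} (f : Orientation h)

/-- A component of `f(h)` containing an element of `f_s(e)` precedes the one containing `f(e)`. -/
def componentRel (C D : f.image.Component) : Prop :=
  ∃ (e : h.Edge) (w v : V), w.1 ∈ f.tail e ∧ v.1 ∈ f.head e ∧
    f.image.adjGraph.connectedComponentMk w = C ∧ f.image.adjGraph.connectedComponentMk v = D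

variable {f}

theorem mem_of_mem_head {e : h.Edge} {x : U} (hx : x ∈ f.head e) : x ∈ e.1 :=
  f.head_subset e hx

theorem mem_of_mem_tail {e : h.Edge} {x : U} (hx : x ∈ f.tail e) : x ∈ e.1 :=
  (Finset.mem_sdiff.1 hx).1

theorem mem_of_mem_edge {e : h.Edge} {x : U} (hx : x ∈ e.1) : x ∈ V :=
  h.subset_of_mem e.1 Multiset.coe_mem hx

theorem mem_image_edges {s : Finset U} : s ∈ f.image.edges ↔ ∃ e, f.head e = s := by
  simp [image]

theorem exists_head_of_reachable {v w : V} (hvw : f.image.adjGraph.Reachable v w) {e : h.Edge}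
    (hv : v.1 ∈ f.head e) :
    ∃ e', Relation.ReflTransGen (fun a b : h.Edge => (f.head a ∩ b.1).Nonempty) e e' ∧
      w.1 ∈ f.head e' := by
  rw [SimpleGraph.reachable_iff_reflTransGen] at hvw
  induction hvw with
  | refl => exact ⟨e, .refl, hv⟩
  | tail _ hadj ih =>
    obtain ⟨e', he', hw⟩ := ih
    obtain ⟨_, s, hs, h₁, h₂⟩ := hadj
    obtain ⟨g, rfl⟩ := mem_image_edges.1 hs
    exact ⟨g, he'.tail ⟨_, Finset.mem_inter.2 ⟨hw, mem_of_mem_head h₁⟩⟩, h₂⟩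

/-- Between two consecutive relations, the path inside the common component lifts to edges whose
heads meet the next edge. -/
theorem exists_chain_of_transGen_componentRel {C D : f.image.Component}
    (hCD : Relation.TransGen f.componentRel C D) :
    ∃ (e e' : h.Edge) (w v : V),
      Relation.ReflTransGen (fun a b : h.Edge => (f.head a ∩ b.1).Nonempty) e e' ∧
      w.1 ∈ f.tail e ∧ v.1 ∈ f.head e' ∧
      f.image.adjGraph.connectedComponentMk w = C ∧
      f.image.adjGraph.connectedComponentMk v = D := by
  induction hCD with
  | single hrel =>
    obtain ⟨e, w, v, hw, hv, hC, hD⟩ := hrel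
    exact ⟨e, e, w, v, .refl, hw, hv, hC, hD⟩
  | tail _ hrel ih =>
    obtain ⟨e, e', w, v, hee, hw, hv, hC, hD⟩ := ih
    obtain ⟨g, w', v', hw', hv', hD', hE⟩ := hrel
    obtain ⟨e'', he'', hw''⟩ := exists_head_of_reachable
      (SimpleGraph.ConnectedComponent.exact (hD.trans hD'.symm)) hv
    exact ⟨e, g, w, v', (hee.trans he'').tail
      ⟨_, Finset.mem_inter.2 ⟨hw'', mem_of_mem_tail hw'⟩⟩, hw, hv', hC, hE⟩

/-- Upgrades "the head meets the next edge" to the two alternatives in the definition of acyclicity.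
When both fail, the next head is contained in the current one, so the next edge can be skipped. -/
theorem exists_head_superset_of_chain {a b : h.Edge}
    (hab : Relation.ReflTransGen (fun a b : h.Edge => (f.head a ∩ b.1).Nonempty) a b) :
    ∃ b', Relation.ReflTransGen (fun a b : h.Edge => (f.head a ∩ f.tail b).Nonempty ∨
      (∅ ⊂ f.head a ∩ b.1 ∧ f.head a ∩ b.1 ⊂ f.head b)) a b' ∧ f.head b ⊆ f.head b' := by
  induction hab with
  | refl => exact ⟨a, .refl, subset_rfl⟩
  | @tail b g _ hbg ih =>
    obtain ⟨b', hb', hsub⟩ := ih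
    have hne : (f.head b' ∩ g.1).Nonempty := hbg.mono (Finset.inter_subset_inter_right hsub)
    by_cases ht : (f.head b' ∩ f.tail g).Nonempty
    · exact ⟨g, hb'.tail (.inl ht), subset_rfl⟩
    by_cases hs : f.head b' ∩ g.1 ⊂ f.head g
    · exact ⟨g, hb'.tail (.inr ⟨Finset.empty_ssubset.2 hne, hs⟩), subset_rfl⟩
    have hle : f.head b' ∩ g.1 ⊆ f.head g := by
      intro x hx
      by_contra hxg
      obtain ⟨h₁, h₂⟩ := Finset.mem_inter.1 hx
      exact ht ⟨x, Finset.mem_inter.2 ⟨h₁, Finset.mem_sdiff.2 ⟨h₂, hxg⟩⟩⟩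
    have heq := hle.eq_or_ssubset.resolve_right hs
    exact ⟨b', hb', heq ▸ Finset.inter_subset_left⟩

/-- A cycle of components unfolds to a chain of edges from `e` to an edge whose head contains a
vertex `w` of the tail of `e`. Skipping edges only enlarges the last head, so `w` still closes the
cycle. -/
theorem IsAcyclic.not_transGen_componentRel (hf : f.IsAcyclic) (C : f.image.Component) :
    ¬ Relation.TransGen f.componentRel C C := by
  intro hC
  obtain ⟨e, e', w, v, hee, hw, hv, hwC, hvC⟩ := exists_chain_of_transGen_componentRel hC
  obtain ⟨e'', he'', hw''⟩ := exists_head_of_reachable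
    (SimpleGraph.ConnectedComponent.exact (hvC.trans hwC.symm)) hv
  obtain ⟨b, hb, hsub⟩ := exists_head_superset_of_chain (hee.trans he'')
  obtain ⟨k, E, hE, h0, hlast, hstep⟩ := exists_injective_chain hb
  refine hf ⟨k, E, hE, hstep, w.1, ?_⟩
  rw [hlast, h0]
  exact Finset.mem_inter.2 ⟨hsub hw'', hw⟩

theorem IsAcyclic.exists_maximal (hf : f.IsAcyclic) (T : Finset f.image.Component)
    (hT : T.Nonempty) : ∃ C ∈ T, ∀ D ∈ T, ¬ f.componentRel C D := by
  let r : f.image.Component → f.image.Component → Prop :=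
    fun C D => Relation.TransGen f.componentRel D C
  have : IsTrans _ r := ⟨fun _ _ _ h₁ h₂ => h₂.trans h₁⟩
  have : Std.Irrefl r := ⟨hf.not_transGen_componentRel⟩
  obtain ⟨C, hC, hmin⟩ := (Finite.wellFounded_of_trans_of_irrefl r).has_min (T : Set _)
    (Finset.coe_nonempty.2 hT)
  exact ⟨C, hC, fun D hD hCD => hmin D hD (.single hCD)⟩

/-- Head colors weakly increase along a chain, so a vertex of the last head lying in the first edge
has maximal color there and cannot be in its tail. -/
theorem maxOrientation_isAcyclic {n : ℕ} (c : V → Fin n) : (maxOrientation h c).IsAcyclic := by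
  rintro ⟨k, e, -, hstep, x, hx⟩
  have hmax : ∀ (g : h.Edge) (x y : V), x.1 ∈ (maxOrientation h c).head g → y.1 ∈ g.1 →
      c y ≤ c x := fun g x y hx hy => (coe_mem_maxSet.1 hx).2 y hy
  have key : ∀ i (x y : V), x.1 ∈ (maxOrientation h c).head (e 0) →
      y.1 ∈ (maxOrientation h c).head (e i) → c x ≤ c y := by
    intro i
    induction i using Fin.induction with
    | zero => exact fun x y hx hy => hmax _ _ _ hy (mem_of_mem_head hx)
    | succ i ih =>
      intro x y hx hy
      obtain ⟨z, hz, hz'⟩ : ∃ z, z ∈ (maxOrientation h c).head (e i.castSucc) ∧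
          z ∈ (e i.succ).1 := by
        rcases hstep i with ⟨z, hz⟩ | ⟨hz, -⟩
        · exact ⟨z, (Finset.mem_inter.1 hz).1, mem_of_mem_tail (Finset.mem_inter.1 hz).2⟩
        · obtain ⟨z, hz⟩ := Finset.empty_ssubset.1 hz
          exact ⟨z, Finset.mem_inter.1 hz⟩
      lift z to V using mem_of_mem_edge hz'
      exact (ih x z hx hz).trans (hmax _ _ _ hy hz')
  obtain ⟨h₁, h₂⟩ := Finset.mem_inter.1 hx
  lift x to V using mem_of_mem_edge (mem_of_mem_tail h₂)
  obtain ⟨h₃, h₄⟩ := Finset.mem_sdiff.1 h₂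
  refine h₄ (coe_mem_maxSet.2 ⟨h₃, fun w hw => ?_⟩)
  obtain ⟨z, hz⟩ := (maxOrientation h c).head_nonempty (e 0)
  lift z to V using mem_of_mem_edge (mem_of_mem_head hz)
  exact (hmax _ _ _ hz hw).trans (key _ z x hz h₁)

theorem maxOrientation_eq_iff {n : ℕ} {c : V → Fin n} :
    maxOrientation h c = f ↔ f.Compatible c ∧
      ∀ (e : h.Edge) (v w : V), v.1 ∈ f.head e → w.1 ∈ f.tail e → c w < c v := by
  constructor
  · rintro rfl
    refine ⟨fun e v w hv hw => (coe_mem_maxSet.1 hv).2 w hw, fun e v w hv hw => ?_⟩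
    obtain ⟨h₁, h₂⟩ := Finset.mem_sdiff.1 hw
    have hv' := (coe_mem_maxSet.1 hv).2
    refine lt_of_le_of_ne (hv' w h₁) fun heq => h₂ (coe_mem_maxSet.2 ⟨h₁, ?_⟩)
    rwa [heq]
  · rintro ⟨hc, hs⟩
    refine Orientation.ext (funext fun e => Finset.ext fun x => ?_)
    by_cases hx : x ∈ V
    · lift x to V using hx
      refine coe_mem_maxSet.trans ⟨fun ⟨h₁, h₂⟩ => ?_, fun hx =>
        ⟨mem_of_mem_head hx, fun w hw => hc e x w hx hw⟩⟩
      by_contra hxe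
      obtain ⟨z, hz⟩ := f.head_nonempty e
      lift z to V using mem_of_mem_edge (mem_of_mem_head hz)
      exact (hs e z x hz (Finset.mem_sdiff.2 ⟨h₁, hxe⟩)).not_ge (h₂ z (mem_of_mem_head hz))
    · exact ⟨fun h => absurd (maxSet_subset_left _ _ h) hx,
        fun h => absurd (mem_of_mem_edge (mem_of_mem_head h)) hx⟩

theorem Compatible.eq_of_reachable {n : ℕ} {c : V → Fin n} (hc : f.Compatible c) {v w : V}
    (hvw : f.image.adjGraph.Reachable v w) : c v = c w := by
  rw [SimpleGraph.reachable_iff_reflTransGen] at hvw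
  induction hvw with
  | refl => rfl
  | tail _ hadj ih =>
    obtain ⟨_, s, hs, h₁, h₂⟩ := hadj
    obtain ⟨g, rfl⟩ := mem_image_edges.1 hs
    exact ih.trans (le_antisymm (hc g _ _ h₂ (mem_of_mem_head h₁))
      (hc g _ _ h₁ (mem_of_mem_head h₂)))

/-! ### Colorings as monotone maps on components -/

theorem mk_eq_of_mem_head {e : h.Edge} {v w : V} (hv : v.1 ∈ f.head e) (hw : w.1 ∈ f.head e) :
    f.image.adjGraph.connectedComponentMk v = f.image.adjGraph.connectedComponentMk w := by
  rcases eq_or_ne v w with rfl | hne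
  · rfl
  · exact SimpleGraph.ConnectedComponent.sound
      (SimpleGraph.Adj.reachable ⟨hne, _, mem_image_edges.2 ⟨e, rfl⟩, hv, hw⟩)

open Classical in
noncomputable instance : Fintype f.image.Component := Fintype.ofFinite _

open Classical in
theorem card_compatibleColorings (n : ℕ) :
    (compatibleColorings f n).card = (weakMaps f.componentRel Finset.univ n).card := by
  symm
  refine Finset.card_bij (fun d hd v => ⟨d (f.image.adjGraph.connectedComponentMk v),
    (mem_weakMaps.1 hd).1.1 _ (Finset.mem_univ _)⟩) ?_ ?_ ?_
  · intro d hd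
    simp only [compatibleColorings, Finset.mem_filter, Finset.mem_univ, true_and]
    intro e v w hv hw
    rw [Fin.mk_le_mk]
    by_cases hw' : w.1 ∈ f.head e
    · rw [mk_eq_of_mem_head hv hw']
    · exact (mem_weakMaps.1 hd).2 _ (Finset.mem_univ _) _ (Finset.mem_univ _)
        ⟨e, w, v, Finset.mem_sdiff.2 ⟨hw, hw'⟩, hv, rfl, rfl⟩
  · intro d _ d' _ hdd
    funext C
    induction C using SimpleGraph.ConnectedComponent.ind with
    | h v => exact congrArg Fin.val (congrFun hdd v)
  · intro c hc
    simp only [compatibleColorings, Finset.mem_filter, Finset.mem_univ, true_and] at hc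
    refine ⟨fun C => C.lift (fun v => (c v).1)
      fun v w p _ => congrArg Fin.val (hc.eq_of_reachable p.reachable), ?_, rfl⟩
    refine mem_weakMaps.2 ⟨⟨fun C _ => ?_, fun C hC => absurd (Finset.mem_univ C) hC⟩, ?_⟩
    · induction C using SimpleGraph.ConnectedComponent.ind with
      | h v => exact (c v).2
    · rintro _ - _ - ⟨e, w, v, hw, hv, rfl, rfl⟩
      exact hc e v w hv (mem_of_mem_tail hw)

open Classical in
theorem card_filter_maxOrientation_eq (n : ℕ) :
    (Finset.univ.filter fun c : V → Fin n => maxOrientation h c = f).card =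
      (strictMaps f.componentRel Finset.univ n).card := by
  symm
  refine Finset.card_bij (fun d hd v => ⟨d (f.image.adjGraph.connectedComponentMk v),
    (mem_strictMaps.1 hd).1.1 _ (Finset.mem_univ _)⟩) ?_ ?_ ?_
  · intro d hd
    have hlt : ∀ (e : h.Edge) (v w : V), v.1 ∈ f.head e → w.1 ∈ f.tail e →
        d (f.image.adjGraph.connectedComponentMk w) < d (f.image.adjGraph.connectedComponentMk v) :=
      fun e v w hv hw => (mem_strictMaps.1 hd).2 _ (Finset.mem_univ _) _ (Finset.mem_univ _)
        ⟨e, w, v, hw, hv, rfl, rfl⟩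
    simp only [Finset.mem_filter, Finset.mem_univ, true_and, maxOrientation_eq_iff]
    refine ⟨fun e v w hv hw => ?_, fun e v w hv hw => Fin.mk_lt_mk.2 (hlt e v w hv hw)⟩
    rw [Fin.mk_le_mk]
    by_cases hw' : w.1 ∈ f.head e
    · rw [mk_eq_of_mem_head hv hw']
    · exact (hlt e v w hv (Finset.mem_sdiff.2 ⟨hw, hw'⟩)).le
  · intro d _ d' _ hdd
    funext C
    induction C using SimpleGraph.ConnectedComponent.ind with
    | h v => exact congrArg Fin.val (congrFun hdd v)
  · intro c hc
    simp only [Finset.mem_filter, Finset.mem_univ, true_and, maxOrientation_eq_iff] at hc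
    obtain ⟨hc, hs⟩ := hc
    refine ⟨fun C => C.lift (fun v => (c v).1)
      fun v w p _ => congrArg Fin.val (hc.eq_of_reachable p.reachable), ?_, rfl⟩
    refine mem_strictMaps.2 ⟨⟨fun C _ => ?_, fun C hC => absurd (Finset.mem_univ C) hC⟩, ?_⟩
    · induction C using SimpleGraph.ConnectedComponent.ind with
      | h v => exact (c v).2
    · rintro _ - _ - ⟨e, w, v, hw, hv, rfl, rfl⟩
      exact hs e v w hv hw

open Classical in
theorem IsAcyclic.exists_polynomial (K : Type*) [Field K] [CharZero K] (hf : f.IsAcyclic) :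
    ∃ p : Polynomial K, ∀ n : ℕ,
      p.eval (n : K) = (Finset.univ.filter fun c : V → Fin n => maxOrientation h c = f).card ∧
      p.eval (-(n : K)) = (-1) ^ f.image.cc * ((compatibleColorings f n).card : K) := by
  obtain ⟨p, hp⟩ := exists_orderPolynomial K hf.exists_maximal Finset.univ
  refine ⟨p, fun n => ⟨?_, ?_⟩⟩
  · rw [(hp n).1, card_filter_maxOrientation_eq]
  · rw [(hp n).2, card_compatibleColorings, Hypergraph.cc, Nat.card_eq_fintype_card,
      Finset.card_univ]

end Orientation

/-! ### Grouping by orientation, and signs for odd characters -/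

section Reciprocity

variable {U : Type u} [DecidableEq U] {V : Finset U} {K : Type v} [Field K]

open Classical in
theorem chi_basisVec_eq_sum_acyclicOrientations (ζ : Character U K) (h : Hypergraph V) (n : ℕ) :
    chi ζ (basisVec h) n = ∑ f ∈ acyclicOrientations h, ζ.eval f.image *
      ((Finset.univ.filter fun c : V → Fin n => maxOrientation h c = f).card : K) := by
  rw [chi_basisVec_eq_sum, ← Finset.sum_fiberwise_of_maps_to (t := acyclicOrientations h)
    (g := fun c => maxOrientation h c)
    fun c _ => Finset.mem_filter.2 ⟨Finset.mem_univ _, Orientation.maxOrientation_isAcyclic c⟩]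
  refine Finset.sum_congr rfl fun f _ => ?_
  rw [Finset.sum_congr rfl fun c hc => by rw [(Finset.mem_filter.1 hc).2], Finset.sum_const,
    nsmul_eq_mul, mul_comm]

/-- All components are odd, and the number of odd components of a graph has the parity of its number
of vertices. -/
theorem Character.IsOdd.neg_one_pow_cc {ζ : Character U K} (hζ : ζ.IsOdd) (g : Hypergraph V)
    (hg : ζ.eval g ≠ 0) : (-1 : K) ^ g.cc = (-1) ^ V.card := by
  have hodd : g.adjGraph.oddComponents = Set.univ := by
    refine Set.eq_univ_of_forall fun C => ?_
    by_contra hC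
    exact hg (hζ V g ⟨C, Nat.not_odd_iff_even.1 hC⟩)
  have h := g.adjGraph.odd_ncard_oddComponents
  rw [hodd, Set.ncard_univ, Nat.card_eq_finsetCard] at h
  rcases Nat.even_or_odd V.card with hV | hV
  · have hcc : Even g.cc := Nat.not_odd_iff_even.1 fun hc => Nat.not_odd_iff_even.2 hV (h.1 hc)
    rw [hV.neg_one_pow, hcc.neg_one_pow]
  · have hcc : Odd g.cc := h.2 hV
    rw [hV.neg_one_pow, hcc.neg_one_pow]

theorem card_compatiblePairs (ζ : Character U K) (h : Hypergraph V) (n : ℕ) :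
    (compatiblePairs ζ h n).card =
      ∑ f ∈ acyclicZetaOrientations ζ h, (compatibleColorings f n).card := by
  classical
  rw [compatiblePairs, Finset.card_filter, Finset.sum_product]
  refine Finset.sum_congr rfl fun f _ => ?_
  rw [compatibleColorings, Finset.card_filter]

theorem card_compatiblePairs_one (ζ : Character U K) (h : Hypergraph V) :
    (compatiblePairs ζ h 1).card = (acyclicZetaOrientations ζ h).card := by
  classical
  rw [card_compatiblePairs, Finset.card_eq_sum_ones]
  refine Finset.sum_congr rfl fun f _ => ?_
  rw [compatibleColorings, Finset.filter_true_of_mem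
    fun c _ e v w _ _ => (Subsingleton.elim (c w) (c v)).le]
  simp

end Reciprocity

end HypergraphMonoid

open HypergraphMonoid in
theorem mainTheorem2 {U : Type*} [DecidableEq U] {K : Type*} [Field K] [CharZero K]
    (ζ : HypergraphMonoid.Character U K) (V : Finset U) (h : HypergraphMonoid.Hypergraph V) :
    ∃ p : Polynomial K,
      (∀ n : ℕ, p.eval (n : K) =
        HypergraphMonoid.chi ζ (HypergraphMonoid.basisVec h) n) ∧
      (∀ n : ℕ, p.eval (-(n : K)) =
        ∑ f ∈ HypergraphMonoid.acyclicOrientations h,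
          (-1 : K) ^ f.image.cc * ζ.eval f.image *
            ((HypergraphMonoid.compatibleColorings f n).card : K)) ∧
      (ζ.IsCharacteristic → ζ.IsOdd →
        (∀ n : ℕ, (-1 : K) ^ V.card * p.eval (-(n : K)) =
          ((HypergraphMonoid.compatiblePairs ζ h n).card : K)) ∧
        (-1 : K) ^ V.card * p.eval (-1 : K) =
          ((HypergraphMonoid.acyclicZetaOrientations ζ h).card : K)) := by
  classical
  have hacyclic : ∀ f ∈ acyclicOrientations h, f.IsAcyclic := fun f hf =>
    (Finset.mem_filter.1 hf).2
  choose! P hP using fun f hf => (hacyclic f hf).exists_polynomial K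
  let p : Polynomial K := ∑ f ∈ acyclicOrientations h, Polynomial.C (ζ.eval f.image) * P f
  have hneg : ∀ n : ℕ, p.eval (-(n : K)) = ∑ f ∈ acyclicOrientations h,
      (-1 : K) ^ f.image.cc * ζ.eval f.image * ((compatibleColorings f n).card : K) := by
    intro n
    rw [Polynomial.eval_finsetSum]
    refine Finset.sum_congr rfl fun f hf => ?_
    rw [Polynomial.eval_mul, Polynomial.eval_C, (hP f hf n).2]
    ring
  have hpairs : ζ.IsCharacteristic → ζ.IsOdd → ∀ n : ℕ,
      (-1 : K) ^ V.card * p.eval (-(n : K)) = ((compatiblePairs ζ h n).card : K) := by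
    intro hchar hodd n
    rw [hneg, card_compatiblePairs, acyclicZetaOrientations, Finset.sum_filter, Nat.cast_sum,
      Finset.mul_sum]
    refine Finset.sum_congr rfl fun f _ => ?_
    by_cases hf : ζ.eval f.image = 0
    · simp [hf]
    · rw [if_pos hf, hodd.neg_one_pow_cc _ hf, (hchar V f.image).resolve_left hf, mul_one,
        ← mul_assoc, ← mul_pow]
      simp
  refine ⟨p, fun n => ?_, hneg, fun hchar hodd => ⟨hpairs hchar hodd, ?_⟩⟩
  · rw [chi_basisVec_eq_sum_acyclicOrientations, Polynomial.eval_finsetSum]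
    refine Finset.sum_congr rfl fun f hf => ?_
    rw [Polynomial.eval_mul, Polynomial.eval_C, (hP f hf n).1]
  -- With one color there is a single coloring, and it is compatible with every orientation.
  · rw [← card_compatiblePairs_one, ← hpairs hchar hodd, Nat.cast_one]
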